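/- Let $d\ge 1$, let $\Omega\subset\mathbb R^d$ be a bounded open set, $T>0$, $m>0$, $\Omega_T=(0,T)\times\Omega$ and $\beta(s)=|s|^{m-1}s$ (with $\beta(0)=0$). Let $f\in L^2(\Omega_T)$, $u_0\in L^{m+1}(\Omega)$, and let $\Lambda$ map $\Omega\times\mathbb R$ into the symmetric real $d\times d$ matrices, be measurable in its first variable, continuous in its second variable, and satisfy, for some $\underline\lambda,\overline\lambda\in(0,\infty)$ and a.e. $x\in\Omega$, $\underline\lambda|\xi|^2\le\Lambda(x,s)\xi\cdot\xi\le\overline\lambda|\xi|^2$ for all $s\in\mathbb R$, $\xi\in\mathbb R^d$. A space-time gradient discretisation $\mathcal D$ (homogeneous Dirichlet conditions, piecewise constant reconstruction) consists of: (i) a finite-dimensional real vector space $X$; (ii) a linear map $\Pi_{\mathcal D}:X\to L^\infty(\Omega)$, a basis $(e_i)_{i\in I}$ of $X$ and pairwise disjoint (possibly empty) sets $\Omega_i\subset\Omega$ $(i\in I)$ such that $\Pi_{\mathcal D}v=\sum_i v_i\mathbf 1_{\Omega_i}$ for every $v=\sum_i v_ie_i\in X$; (iii) a linear map $\nabla_{\mathcal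 D}:X\to L^2(\Omega)^d$ such that $\|\nabla_{\mathcal D}\cdot\|_{L^2(\Omega)}$ is a norm on $X$; (iv) a map $\mathcal I_{\mathcal D}:L^{m+1}(\Omega)\to X$; (v) times $0=t^{(0)}<t^{(1)}<\dots<t^{(N)}=T$. For $v=\sum_iv_ie_i\in X$ put $\beta(v)=\sum_i\beta(v_i)e_i$. For a family $v=(v^{(n)})_{n=0,\dots,N}$ in $X$ let $\beta(v)=(\beta(v^{(n)}))_{n=0,\dots,N}$, let $\Pi_{\mathcal D}v(0,\cdot)=\Pi_{\mathcal D}v^{(0)}$ and, for $n=0,\dots,N-1$ and $t\in(t^{(n)},t^{(n+1)}]$, let $$\Pi_{\mathcal D}v(t,\cdot)=\Pi_{\mathcal D}v^{(n+1)},\qquad \nabla_{\mathcal D}v(t,\cdot)=\nabla_{\mathcal D}v^{(n+1)},\qquad \delta_{\mathcal D}v(t)=\frac{\Pi_{\mathcal D}v^{(n+1)}-\Pi_{\mathcal D}v^{(n)}}{t^{(n+1)}-t^{(n)}}.$$ Then for every such $\mathcal D$ the implicit gradient scheme for $\partial_tu-\operatorname{div}(\Lambda(\cdot,u)\nabla\beta(u))=f$,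 $u(0,\cdot)=u_0$, with homogeneous Dirichlet boundary conditions has at least one solution: there is a family $u=(u^{(n)})_{n=0,\dots,N}$ in $X$ with $u^{(0)}=\mathcal I_{\mathcal D}u_0$ such that, for all families $\phi=(\phi^{(n)})_{n=0,\dots,N}$ in $X$, $$\int_{\Omega_T}\delta_{\mathcal D}u\,\Pi_{\mathcal D}\phi\,dx\,dt+\int_{\Omega_T}\Lambda(x,\Pi_{\mathcal D}u)\nabla_{\mathcal D}\beta(u)\cdot\nabla_{\mathcal D}\phi\,dx\,dt=\int_{\Omega_T}f\,\Pi_{\mathcal D}\phi\,dx\,dt.$$ -/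

import Mathlib

open MeasureTheory Set
open scoped ENNReal

noncomputable section

namespace PorousMedium

/-- The nonlinearity `β(s) = |s|^(m-1) s` of the porous medium equation. -/
def beta (m : ℝ) (s : ℝ) : ℝ := |s| ^ (m - 1) * s

/-- The space-time cylinder `Ω_T = (0,T) × Ω`. -/
def cylinder {d : ℕ} (Ω : Set (EuclideanSpace ℝ (Fin d))) (T : ℝ) :
    Set (ℝ × EuclideanSpace ℝ (Fin d)) :=
  Ioo 0 T ×ˢ Ω

/-- Standing assumptions on the diffusion tensor `Λ : Ω × ℝ → S^d(ℝ)`: symmetric,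
(Lebesgue) measurable in the space variable, continuous in the second variable,
uniformly elliptic and bounded. -/
structure IsDiffusionTensor {d : ℕ} (Ω : Set (EuclideanSpace ℝ (Fin d)))
    (Λ : EuclideanSpace ℝ (Fin d) → ℝ → Matrix (Fin d) (Fin d) ℝ) : Prop where
  symm : ∀ x ∈ Ω, ∀ s, (Λ x s).IsSymm
  measurable : ∀ s i j, AEMeasurable (fun x => Λ x s i j) (volume.restrict Ω)
  continuous : ∀ x ∈ Ω, Continuous (fun s => Λ x s)
  elliptic : ∃ lo hi : ℝ, 0 < lo ∧ 0 < hi ∧ ∀ᵐ x ∂(volume.restrict Ω),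
    ∀ (s : ℝ) (ξ : EuclideanSpace ℝ (Fin d)),
      lo * ‖ξ‖ ^ 2 ≤ inner ℝ (Matrix.toEuclideanLin (Λ x s) ξ) ξ ∧
      inner ℝ (Matrix.toEuclideanLin (Λ x s) ξ) ξ ≤ hi * ‖ξ‖ ^ 2

/-- A space-time gradient discretisation for homogeneous Dirichlet boundary conditions with
piecewise constant reconstruction. `X` is the finite-dimensional space of discrete unknowns.
The basis `(e_i)` and the cells `(Ω_i)` are recorded as data, because the nodal operation
`v ↦ g(v)` on discrete unknowns refers to them. Cells may be empty. -/
structure GradientDiscretisation {d : ℕ} (Ω : Set (EuclideanSpace ℝ (Fin d))) (m T : ℝ)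
    (X : Type*) [AddCommGroup X] [Module ℝ X] [FiniteDimensional ℝ X]
    (ι : Type*) [Fintype ι] where
  /-- function reconstruction `Π_D : X → L^∞(Ω)` -/
  recon : X →ₗ[ℝ] Lp ℝ ∞ (volume.restrict Ω)
  /-- the basis `(e_i)` -/
  basis : Module.Basis ι ℝ X
  /-- the sets `Ω_i` -/
  cell : ι → Set (EuclideanSpace ℝ (Fin d))
  cell_subset : ∀ i, cell i ⊆ Ω
  cell_disjoint : Pairwise fun i j => Disjoint (cell i) (cell j)
  recon_eq : ∀ v : X, recon v =ᵐ[volume.restrict Ω]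
    fun x => ∑ i, basis.repr v i * (cell i).indicator (fun _ => (1 : ℝ)) x
  /-- discrete gradient `∇_D : X → L²(Ω)^d` -/
  grad : X →ₗ[ℝ] Lp (EuclideanSpace ℝ (Fin d)) 2 (volume.restrict Ω)
  /-- `‖∇_D ·‖` is a norm on `X`; the other norm axioms follow from linearity of `grad`. -/
  grad_norm_definite : ∀ v : X, ‖grad v‖ = 0 → v = 0
  /-- interpolation operator `I_D : L^(m+1)(Ω) → X`, an arbitrary map -/
  interp : Lp ℝ (ENNReal.ofReal (m + 1)) (volume.restrict Ω) → X
  /-- number of time steps -/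
  N : ℕ
  /-- the times `t^(0), …, t^(N)` -/
  time : Fin (N + 1) → ℝ
  time_strictMono : StrictMono time
  time_zero : time 0 = 0
  time_last : time (Fin.last N) = T

namespace GradientDiscretisation

variable {d : ℕ} {Ω : Set (EuclideanSpace ℝ (Fin d))} {m T : ℝ}
  {X : Type*} [AddCommGroup X] [Module ℝ X] [FiniteDimensional ℝ X]
  {ι : Type*} [Fintype ι] (D : GradientDiscretisation Ω m T X ι)

/-- `g(v) = ∑ i, g(v_i) e_i` for `v = ∑ i, v_i e_i`. -/
def nodal (g : ℝ → ℝ) (v : X) : X := ∑ i, g (D.basis.repr v i) • D.basis i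

/-- The function of `(t,x)` that equals `w n x` for `t ∈ (t^(n), t^(n+1)]`. -/
def piecewiseInTime {F : Type*} [AddCommMonoid F]
    (w : Fin D.N → EuclideanSpace ℝ (Fin d) → F) (p : ℝ × EuclideanSpace ℝ (Fin d)) : F :=
  ∑ n : Fin D.N,
    (Ioc (D.time n.castSucc) (D.time n.succ)).indicator (fun _ => w n p.2) p.1

open Classical in
/-- The space-time reconstruction `Π_D v`: it is `Π_D v^(0)` at `t = 0` and `Π_D v^(n+1)` on
`(t^(n), t^(n+1)]`. -/
def reconST (v : Fin (D.N + 1) → X) (p : ℝ × EuclideanSpace ℝ (Fin d)) : ℝ :=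
  if p.1 = 0 then D.recon (v 0) p.2
  else D.piecewiseInTime (fun n => D.recon (v n.succ)) p

/-- The space-time gradient `∇_D v`: it is `∇_D v^(n+1)` on `(t^(n), t^(n+1)]`. -/
def gradST (v : Fin (D.N + 1) → X) (p : ℝ × EuclideanSpace ℝ (Fin d)) :
    EuclideanSpace ℝ (Fin d) :=
  D.piecewiseInTime (fun n => D.grad (v n.succ)) p

/-- The discrete time derivative `δ_D v`: it is
`(Π_D v^(n+1) - Π_D v^(n)) / (t^(n+1) - t^(n))` on `(t^(n), t^(n+1)]`. -/
def deltaST (v : Fin (D.N + 1) → X) (p : ℝ × EuclideanSpace ℝ (Fin d)) : ℝ :=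
  D.piecewiseInTime
    (fun n x => (D.recon (v n.succ) x - D.recon (v n.castSucc) x) /
      (D.time n.succ - D.time n.castSucc)) p

/-- `u = (u^(n))` solves the implicit-in-time gradient scheme for
`∂_t u - div(Λ(·,u) ∇β(u)) = f` with initial datum `u₀`. -/
structure IsSchemeSolution
    (Λ : EuclideanSpace ℝ (Fin d) → ℝ → Matrix (Fin d) (Fin d) ℝ)
    (f : ℝ × EuclideanSpace ℝ (Fin d) → ℝ)
    (u₀ : Lp ℝ (ENNReal.ofReal (m + 1)) (volume.restrict Ω))
    (u : Fin (D.N + 1) → X) : Prop where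
  initial : u 0 = D.interp u₀
  equation : ∀ φ : Fin (D.N + 1) → X,
    (∫ p in cylinder Ω T, D.deltaST u p * D.reconST φ p) +
      (∫ p in cylinder Ω T,
        inner ℝ (Matrix.toEuclideanLin (Λ p.2 (D.reconST u p))
          (D.gradST (fun n => D.nodal (beta m) (u n)) p)) (D.gradST φ p)) =
    ∫ p in cylinder Ω T, f p * D.reconST φ p

end GradientDiscretisation

end PorousMedium

end

/-! The scheme is implicit and a test family may be chosen independently at each time level, so it
decouples into one nonlinear finite-dimensional problem per step, solved successively from `D.interp
u₀` (`exists_step`).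

In one step the unknown is changed to the coordinate vector `v` of `β(u)`; since `beta m⁻¹` inverts
`beta m`, `u` is recovered nodally and continuously. The residual of the step, tested against the
basis, is then a continuous field `P` on a Euclidean space. In the pairing of `P v` with `v`, the
mass term of the new iterate is nonnegative, because reconstruction is piecewise constant and
`β⁻¹(s) s ≥ 0`. The diffusion term dominates a multiple of `‖v‖²`, because `Λ` is elliptic and the
discrete gradient is injective. The remaining terms are linear in `v`. So `P` points outwards on a
large sphere.

Such a field has a zero (`exists_eq_zero_of_inner_pos`): otherwise a smooth approximation of it,
glued to the identity outside the ball, would normalise to a `C¹` retraction `r` onto the sphere.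
This is impossible (`not_exists_contDiff_retraction`): the integral over the ball of the Jacobian of
`id + t (r - id)` is a polynomial in `t`, equal to the volume of the ball for small `t ≥ 0`, yet
zero at `t = 1`, where the Jacobian is `det Dr = 0`. -/

namespace PorousMedium

/-! ### No-retraction theorem and zeros of outward-pointing fields. -/

section ZeroOfField

open Topology Metric
open scoped ContDiff Manifold

variable {E : Type*} [NormedAddCommGroup E] [InnerProductSpace ℝ E] [FiniteDimensional ℝ E]

/-- `t ↦ det (1 + t A)` is a polynomial of degree at most `dim E`, so its value at `1` is a fixed
linear combination of its values at `dim E + 1` distinct nodes. -/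
theorem exists_det_one_add_eq_sum (ts : Fin (Module.finrank ℝ E + 1) → ℝ)
    (hts : Function.Injective ts) :
    ∃ c : Fin (Module.finrank ℝ E + 1) → ℝ, ∀ A : E →L[ℝ] E,
      (1 + A).det = ∑ j, c j * (1 + ts j • A).det := by
  classical
  refine ⟨fun j => (Lagrange.basis Finset.univ ts j).eval 1, fun A => ?_⟩
  let b := Module.finBasis ℝ E
  let M := LinearMap.toMatrix b b (A : E →ₗ[ℝ] E)
  let p : Polynomial ℝ := Matrix.det ((Polynomial.X : Polynomial ℝ) • M.map Polynomial.C +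
    (1 : Matrix _ _ ℝ).map Polynomial.C)
  have hev : ∀ t : ℝ, p.eval t = (1 + t • A).det := by
    intro t
    have h1 : (1 + t • A).det = Matrix.det (t • M + 1) := by
      rw [ContinuousLinearMap.det, ← LinearMap.det_toMatrix b]
      congr 1
      simp [M, map_add, add_comm, LinearMap.toMatrix_one]
    rw [h1]
    simp only [p]
    rw [← Polynomial.coe_evalRingHom, RingHom.map_det]
    congr 1
    ext i j
    by_cases hij : i = j <;> simp [hij] <;> ring
  have hdeg : p.degree < (Finset.univ : Finset (Fin (Module.finrank ℝ E + 1))).card := by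
    have h := Polynomial.natDegree_det_X_add_C_le M (1 : Matrix _ _ ℝ)
    refine lt_of_le_of_lt Polynomial.degree_le_natDegree ?_
    simp only [Fintype.card_fin, Finset.card_univ] at h ⊢
    exact_mod_cast Nat.lt_succ_of_le h
  have hp := Lagrange.eq_interpolate (s := Finset.univ) (v := ts) (f := p)
    (hts.injOn) hdeg
  have h1 := hev 1
  rw [one_smul] at h1
  rw [← h1, hp, Lagrange.interpolate_apply, Polynomial.eval_finsetSum]
  refine Finset.sum_congr rfl fun j _ => ?_
  rw [Polynomial.eval_mul, Polynomial.eval_C, hev, mul_comm]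

/-- The segment from `1` to `1 + A` consists of invertible maps by the Neumann series, so the
determinant keeps the sign it has at `1`. -/
theorem det_one_add_pos {A : E →L[ℝ] E} (hA : ‖A‖ < 1) : 0 < (1 + A).det := by
  have hcont : Continuous fun s : ℝ => (1 + s • A).det := by
    have h1 : Continuous fun s : ℝ => 1 + s • A := by fun_prop
    exact ContinuousLinearMap.continuous_det.comp h1
  have hne : ∀ s ∈ Icc (0 : ℝ) 1, (1 + s • A).det ≠ 0 := by
    intro s hs
    have h1 : ‖-(s • A)‖ < 1 := by
      rw [norm_neg, norm_smul, Real.norm_of_nonneg hs.1]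
      nlinarith [hs.2, norm_nonneg A]
    have hu := isUnit_one_sub_of_norm_lt_one h1
    rw [sub_neg_eq_add] at hu
    have h2 : IsUnit ((1 + s • A : E →L[ℝ] E) : E →ₗ[ℝ] E) :=
      hu.map ContinuousLinearMap.toLinearMapRingHom
    exact (LinearMap.isUnit_iff_isUnit_det _).1 h2 |>.ne_zero
  by_contra! hle
  have hivt := intermediate_value_Icc' (zero_le_one (α := ℝ)) hcont.continuousOn
  have h0 : (0 : ℝ) ∈ Icc ((1 + (1 : ℝ) • A).det) ((1 + (0 : ℝ) • A).det) := by
    rw [one_smul, zero_smul, add_zero]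
    refine ⟨hle, ?_⟩
    simp [ContinuousLinearMap.det]
  obtain ⟨s, hs, hs0⟩ := hivt h0
  exact hne s hs hs0

/-- A `C¹` map of constant nonzero norm near `x` has singular derivative at `x`. -/
theorem det_fderiv_eq_zero_of_norm_eq {r : E → E} {R : ℝ} (hR : 0 < R) {x : E}
    (hd : DifferentiableAt ℝ r x) (hr : ∀ᶠ y in 𝓝 x, ‖r y‖ = R) : (fderiv ℝ r x).det = 0 := by
  -- Differentiating the constant `‖r‖²` puts the range of the derivative in the orthogonal
  -- complement of the nonzero vector `r x`.
  have horth : ∀ v, inner ℝ (r x) (fderiv ℝ r x v) = 0 := by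
    intro v
    have h1 := hd.hasFDerivAt.inner ℝ hd.hasFDerivAt
    have h2 : (fun y => inner ℝ (r y) (r y)) =ᶠ[𝓝 x] fun _ => R ^ 2 := by
      filter_upwards [hr] with y hy
      rw [real_inner_self_eq_norm_sq, hy]
    have h3 := (h1.congr_of_eventuallyEq h2.symm).unique (hasFDerivAt_const (R ^ 2) x)
    have h4 := congrArg (fun L : E →L[ℝ] ℝ => L v) h3
    simp only [ContinuousLinearMap.comp_apply, ContinuousLinearMap.prod_apply,
      fderivInnerCLM_apply, zero_apply] at h4
    rw [real_inner_comm (r x) (fderiv ℝ r x v)] at h4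
    linarith
  by_contra hne
  have hu : IsUnit (LinearMap.det (fderiv ℝ r x : E →ₗ[ℝ] E)) := isUnit_iff_ne_zero.2 hne
  have hsurj := (LinearMap.isUnit_iff_range_eq_top _).1 ((LinearMap.isUnit_iff_isUnit_det _).2 hu)
  obtain ⟨v, hv⟩ := LinearMap.range_eq_top.1 hsurj (r x)
  have h := horth v
  rw [ContinuousLinearMap.coe_coe] at hv
  rw [hv, real_inner_self_eq_norm_sq, hr.self_of_nhds] at h
  nlinarith

/-- A map that is Lipschitz on a closed ball and vanishes off the open ball is Lipschitz. -/
theorem lipschitzWith_of_eq_zero_off_ball {E : Type*} [NormedAddCommGroup E]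
    [InnerProductSpace ℝ E] {g : E → E} {R : ℝ} {K : NNReal}
    (hg : LipschitzOnWith K g (closedBall 0 R)) (h0 : ∀ x, R ≤ ‖x‖ → g x = 0) :
    LipschitzWith K g := by
  -- The segment from `x` to `y` meets the sphere at some `z`; there `g z = 0 = g y`, and `z` is no
  -- farther from `x` than `y` is.
  have key : ∀ x y : E, ‖x‖ ≤ R → R ≤ ‖y‖ → dist (g x) (g y) ≤ K * dist x y := by
    intro x y hx hy
    have hc : Continuous fun s : ℝ => ‖AffineMap.lineMap (k := ℝ) x y s‖ := by
      fun_prop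
    obtain ⟨s, hs, hsR⟩ := intermediate_value_Icc (zero_le_one (α := ℝ)) hc.continuousOn
      (show R ∈ Icc _ _ by simpa using ⟨hx, hy⟩)
    set z := AffineMap.lineMap (k := ℝ) x y s
    have hz := hg.dist_le_mul x (by simpa using hx) z (by simpa using hsR.le)
    rw [h0 y hy, ← h0 z hsR.ge]
    refine hz.trans ?_
    gcongr
    rw [dist_left_lineMap, Real.norm_of_nonneg hs.1]
    nlinarith [hs.2, dist_nonneg (x := x) (y := y)]
  refine LipschitzWith.of_dist_le_mul fun x y => ?_
  rcases le_total ‖x‖ R with hx | hx <;> rcases le_total ‖y‖ R with hy | hy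
  · exact hg.dist_le_mul x (by simpa using hx) y (by simpa using hy)
  · exact key x y hx hy
  · rw [dist_comm, dist_comm x]; exact key y x hy hx
  · rw [h0 x hx, h0 y hy, dist_self]; positivity

/-- For small `t`, the map `id + t (r - id)` is a diffeomorphism of the ball, so the integral of
its Jacobian is the volume of the ball. -/
theorem integral_det_eq_volume_ball [MeasurableSpace E] [BorelSpace E] {r : E → E} {R : ℝ}
    (hr : ContDiff ℝ 1 r)
    (hid : ∀ x, ‖x‖ = R → r x = x) (hsph : ∀ x, ‖x‖ ≤ R → ‖r x‖ = R) {K : NNReal}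
    (hK : LipschitzOnWith K (fun x => r x - x) (closedBall 0 R)) {t : ℝ} (ht0 : 0 ≤ t)
    (ht1 : t < 1) (htK : t * K < 1) :
    IntegrableOn (fun x => (1 + t • (fderiv ℝ r x - 1)).det) (ball 0 R) ∧
      ∫ x in ball (0 : E) R, (1 + t • (fderiv ℝ r x - 1)).det = volume.real (ball (0 : E) R) := by
  classical
  let g : E → E := (closedBall 0 R).indicator fun x => r x - x
  have hgin : ∀ x, ‖x‖ ≤ R → g x = r x - x := fun x hx =>
    indicator_of_mem (by simpa using hx) _
  have hgout : ∀ x, R ≤ ‖x‖ → g x = 0 := by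
    intro x hx
    rcases hx.eq_or_lt with h | h
    · rw [hgin x h.ge, hid x h.symm, sub_self]
    · exact indicator_of_notMem (by simpa using h) _
  have hgL : LipschitzWith K g := by
    refine lipschitzWith_of_eq_zero_off_ball (R := R) (fun x hx y hy => ?_) hgout
    rw [hgin x (by simpa using hx), hgin y (by simpa using hy)]
    exact hK hx hy
  let F : E → E := fun x => x + t • g x
  have hFinj : Function.Injective F := by
    intro x y hxy
    have h1 : x - y = t • (g y - g x) := by
      have : x + t • g x = y + t • g y := hxy
      rw [smul_sub, sub_eq_sub_iff_add_eq_add, this, add_comm]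
    have h2 : ‖x - y‖ ≤ t * K * ‖x - y‖ := by
      calc ‖x - y‖ = t * ‖g y - g x‖ := by rw [h1, norm_smul, Real.norm_of_nonneg ht0]
        _ ≤ t * (K * ‖y - x‖) := by
          gcongr; simpa [dist_eq_norm] using hgL.dist_le_mul y x
        _ = t * K * ‖x - y‖ := by rw [norm_sub_rev]; ring
    have h3 : ‖x - y‖ = 0 := by nlinarith [norm_nonneg (x - y)]
    exact sub_eq_zero.1 (norm_eq_zero.1 h3)
  -- A preimage of `y` is a fixed point of `x ↦ y - t g(x)`, a contraction because `t K < 1`.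
  have hFsurj : Function.Surjective F := by
    intro y
    have hc : ContractingWith (Real.toNNReal (t * K)) fun x => y - t • g x := by
      refine ⟨by rw [← NNReal.coe_lt_coe, Real.coe_toNNReal _ (by positivity)]; exact_mod_cast htK,
        LipschitzWith.of_dist_le_mul fun x z => ?_⟩
      rw [Real.coe_toNNReal _ (by positivity), dist_sub_left, dist_smul₀,
        Real.norm_of_nonneg ht0, mul_assoc]
      gcongr
      exact hgL.dist_le_mul x z
    have hfix := hc.fixedPoint_isFixedPt
    refine ⟨_, (?_ : F (ContractingWith.fixedPoint _ hc) = y)⟩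
    have h : y - t • g (ContractingWith.fixedPoint _ hc) = ContractingWith.fixedPoint _ hc := hfix
    simp only [F]
    nth_rewrite 1 [← h]
    abel
  -- Inside the ball, `F x` is a convex combination of `x` and `r x` with weight `1 - t > 0` on `x`,
  -- hence of norm `< R`. Outside, `F` is the identity, so a preimage of a point of the ball lies in
  -- the ball.
  have himage : F '' ball 0 R = ball 0 R := by
    have hout : ∀ x, R ≤ ‖x‖ → F x = x := fun x hx => by simp [F, hgout x hx]
    ext y
    constructor
    · rintro ⟨x, hx, rfl⟩
      have hx' : ‖x‖ < R := by simpa using hx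
      have : F x = (1 - t) • x + t • r x := by
        simp only [F, hgin x hx'.le, smul_sub, sub_smul, one_smul]; abel
      rw [mem_ball_zero_iff, this]
      calc ‖(1 - t) • x + t • r x‖ ≤ (1 - t) * ‖x‖ + t * ‖r x‖ := by
            refine (norm_add_le _ _).trans ?_
            rw [norm_smul, norm_smul, Real.norm_of_nonneg ht0, Real.norm_of_nonneg (by linarith)]
        _ < R := by rw [hsph x hx'.le]; nlinarith
    · intro hy
      obtain ⟨x, rfl⟩ := hFsurj y
      refine ⟨x, ?_, rfl⟩
      by_contra hx
      have hx' : R ≤ ‖x‖ := by simpa using hx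
      rw [hout x hx'] at hy
      exact hx hy
  have hderiv : ∀ x ∈ ball (0 : E) R,
      HasFDerivWithinAt F (1 + t • (fderiv ℝ r x - 1)) (ball 0 R) x := by
    intro x hx
    have h1 : HasFDerivAt (fun x => x + t • (r x - x)) (1 + t • (fderiv ℝ r x - 1)) x := by
      have h2 := ((hr.differentiable one_ne_zero) x).hasFDerivAt
      exact (hasFDerivAt_id x).add ((h2.sub (hasFDerivAt_id x)).const_smul t)
    refine h1.hasFDerivWithinAt.congr (fun y hy => ?_) ?_
    · simp [F, hgin y (by simpa using (mem_ball_zero_iff.1 hy).le)]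
    · simp [F, hgin x (by simpa using (mem_ball_zero_iff.1 hx).le)]
  -- Positivity removes the absolute value from the change of variables formula, leaving a
  -- polynomial in `t`.
  have hpos : ∀ x ∈ ball (0 : E) R, 0 < (1 + t • (fderiv ℝ r x - 1)).det := by
    intro x hx
    apply det_one_add_pos
    have h1 : HasFDerivAt (fun x => r x - x) (fderiv ℝ r x - 1) x :=
      ((hr.differentiable one_ne_zero) x).hasFDerivAt.sub (hasFDerivAt_id x)
    have h2 : ‖fderiv ℝ r x - 1‖ ≤ K :=
      h1.le_of_lipschitzOn (Filter.mem_of_superset (isOpen_ball.mem_nhds hx) ball_subset_closedBall)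
        hK
    rw [norm_smul, Real.norm_of_nonneg ht0]
    nlinarith
  have hcongr : EqOn (fun x => |(1 + t • (fderiv ℝ r x - 1)).det| • (1 : ℝ))
      (fun x => (1 + t • (fderiv ℝ r x - 1)).det) (ball (0 : E) R) := fun x hx => by
    simp [abs_of_pos (hpos x hx)]
  constructor
  · have h := (integrableOn_image_iff_integrableOn_abs_det_fderiv_smul volume measurableSet_ball
      hderiv hFinj.injOn fun _ => (1 : ℝ)).1 (by rw [himage]; exact integrableOn_const (by finiteness))
    exact h.congr_fun hcongr measurableSet_ball
  · have h := integral_image_eq_integral_abs_det_fderiv_smul volume measurableSet_ball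
      hderiv hFinj.injOn fun _ => (1 : ℝ)
    rw [himage, setIntegral_congr_fun measurableSet_ball hcongr] at h
    rw [← h]
    simp

/-- There is no `C¹` retraction of a closed ball onto its sphere. -/
theorem not_exists_contDiff_retraction {r : E → E} {R : ℝ} (hR : 0 < R) (hr : ContDiff ℝ 1 r)
    (hid : ∀ x, ‖x‖ = R → r x = x) (hsph : ∀ x, ‖x‖ ≤ R → ‖r x‖ = R) : False := by
  borelize E
  obtain ⟨K, hK⟩ : ∃ K, LipschitzOnWith K (fun x => r x - x) (closedBall 0 R) :=
    (hr.sub contDiff_id).contDiffOn.exists_lipschitzOnWith one_ne_zero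
      (convex_closedBall 0 R) (isCompact_closedBall 0 R)
  let n := Module.finrank ℝ E
  -- `n + 1` distinct nodes in `[0, 1 / (K + 1))`, so that both `t < 1` and `t K < 1` hold at each
  -- of them.
  let ts : Fin (n + 1) → ℝ := fun j => j / ((n + 1) * (K + 1))
  have hden : (0 : ℝ) < (n + 1) * (K + 1) := by positivity
  have hts : Function.Injective ts := by
    intro i j hij
    simp only [ts] at hij
    rw [div_left_inj' hden.ne'] at hij
    exact Fin.ext (by exact_mod_cast hij)
  have hlt : ∀ j, ts j < 1 / (K + 1) := by
    intro j
    simp only [ts]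
    rw [div_lt_div_iff₀ hden (by positivity)]
    have : (j : ℝ) < n + 1 := by exact_mod_cast j.2
    nlinarith [K.coe_nonneg]
  have hts0 : ∀ j, 0 ≤ ts j := fun j => by positivity
  have hts1 : ∀ j, ts j * (K + 1) < 1 := fun j => by
    have := hlt j
    rwa [lt_div_iff₀ (by positivity)] at this
  obtain ⟨c, hc⟩ := exists_det_one_add_eq_sum (E := E) ts hts
  -- The interpolation identity at `A = 0`.
  have hsum : ∑ j, c j = 1 := by
    have := hc 0
    simp only [smul_zero, add_zero] at this
    simpa [ContinuousLinearMap.det] using this.symm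
  have hI : ∀ j, _ := fun j => integral_det_eq_volume_ball hr hid hsph hK (hts0 j)
    (by nlinarith [hts0 j, hts1 j, K.coe_nonneg]) (by nlinarith [hts0 j, hts1 j, K.coe_nonneg])
  have h1 : ∫ x in ball (0 : E) R, (1 + (fderiv ℝ r x - 1)).det = volume.real (ball (0 : E) R) := by
    rw [integral_congr_ae (ae_of_all _ fun x => hc (fderiv ℝ r x - 1))]
    rw [integral_finsetSum _ fun j _ => (hI j).1.const_mul _]
    simp_rw [integral_const_mul, (hI _).2]
    rw [← Finset.sum_mul, hsum, one_mul]
  have h2 : ∫ x in ball (0 : E) R, (1 + (fderiv ℝ r x - 1)).det = 0 := by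
    rw [setIntegral_congr_fun measurableSet_ball (g := fun _ => (0 : ℝ))]
    · simp
    · intro x hx
      simp only [add_sub_cancel]
      refine det_fderiv_eq_zero_of_norm_eq hR (hr.differentiable one_ne_zero x) ?_
      filter_upwards [isOpen_ball.mem_nhds hx] with y hy
      exact hsph y (mem_ball_zero_iff.1 hy).le
  have h3 : 0 < volume.real (ball (0 : E) R) :=
    ENNReal.toReal_pos (measure_ball_pos volume 0 hR).ne' (by finiteness)
  linarith

/-- A continuous field on a closed ball that points outwards on the sphere has a zero. -/
theorem exists_eq_zero_of_inner_pos {P : E → E} (hP : Continuous P) {R : ℝ} (hR : 0 < R)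
    (hpos : ∀ x, ‖x‖ = R → 0 < inner ℝ (P x) x) : ∃ x, P x = 0 := by
  by_contra! hne
  -- Convex constraints on a smooth selection `h`: positive pairing with `P` on the closed ball, and
  -- `h x = x` off the open ball. Both apply on the sphere, where they are compatible by `hpos`.
  let t : E → Set E := fun x => {y | (‖x‖ ≤ R → 0 < inner ℝ (P x) y) ∧ (R ≤ ‖x‖ → y = x)}
  have hconv : ∀ x, Convex ℝ (t x) := by
    intro x y hy z hz a b ha hb hab
    refine ⟨fun hx => ?_, fun hx => ?_⟩
    · rw [inner_add_right, inner_smul_right, inner_smul_right]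
      have h1 := hy.1 hx
      have h2 := hz.1 hx
      rcases ha.eq_or_lt with rfl | ha
      · simp_all
      · exact add_pos_of_pos_of_nonneg (mul_pos ha h1) (mul_nonneg hb h2.le)
    · rw [hy.2 hx, hz.2 hx, ← add_smul, hab, one_smul]
  -- Local selections: the constant `P x` inside the ball, the identity on and outside the sphere. A
  -- partition of unity then glues them.
  have hloc : ∀ x : E, ∃ U ∈ 𝓝 x, ∃ g : E → E,
      ContMDiffOn 𝓘(ℝ, E) 𝓘(ℝ, E) ∞ g U ∧ ∀ y ∈ U, g y ∈ t y := by
    intro x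
    rcases lt_or_ge ‖x‖ R with hx | hx
    · have h1 : ∀ᶠ y in 𝓝 x, ‖y‖ < R := continuous_norm.continuousAt.eventually_lt_const hx
      have h2 : ∀ᶠ y in 𝓝 x, 0 < inner ℝ (P y) (P x) := by
        have hc : Continuous fun y => inner ℝ (P y) (P x) := by fun_prop
        exact hc.continuousAt.eventually_const_lt (real_inner_self_pos.2 (hne x))
      refine ⟨_, h1.and h2, fun _ => P x, contMDiffOn_const, fun y hy => ⟨fun _ => hy.2, fun h => ?_⟩⟩
      exact absurd hy.1 (not_lt.2 h)
    · rcases hx.eq_or_lt with hx | hx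
      · have h2 : ∀ᶠ y in 𝓝 x, 0 < inner ℝ (P y) y := by
          have hc : Continuous fun y => inner ℝ (P y) y := by fun_prop
          exact hc.continuousAt.eventually_const_lt (hpos x hx.symm)
        exact ⟨_, h2, id, contMDiffOn_id, fun y hy => ⟨fun _ => hy, fun _ => rfl⟩⟩
      · have h1 : ∀ᶠ y in 𝓝 x, R < ‖y‖ := continuous_norm.continuousAt.eventually_const_lt hx
        exact ⟨_, h1, id, contMDiffOn_id, fun y hy =>
          ⟨fun h => absurd (mem_ofPred.1 hy) (not_lt.2 h), fun _ => rfl⟩⟩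
  obtain ⟨h, hh⟩ := exists_contMDiffMap_forall_mem_convex_of_local 𝓘(ℝ, E) (n := ⊤) hconv hloc
  have hh0 : ∀ x, h x ≠ 0 := by
    intro x h0
    rcases le_total ‖x‖ R with hx | hx
    · have := (hh x).1 hx
      simp [h0] at this
    · have := (hh x).2 hx
      rw [h0] at this
      rw [← this, norm_zero] at hx
      linarith
  have hhs : ContDiff ℝ 1 h := (contMDiff_iff_contDiff.1 h.contMDiff).of_le (by exact_mod_cast le_top)
  refine not_exists_contDiff_retraction (r := fun x => (R / ‖h x‖) • h x) hR ?_ ?_ ?_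
  · exact (contDiff_const.div (hhs.norm ℝ hh0) fun x => norm_ne_zero_iff.2 (hh0 x)).smul hhs
  · intro x hx
    simp only [(hh x).2 hx.ge, hx, div_self hR.ne', one_smul]
  · intro x _
    rw [norm_smul, norm_div, norm_norm, div_mul_cancel₀ _ (norm_ne_zero_iff.2 (hh0 x)),
      Real.norm_of_nonneg hR.le]

/-- The quadratic term wins on the sphere of radius `(|C| + 1) / a`. -/
theorem exists_eq_zero_of_coercive {P : E → E} (hP : Continuous P) {a C : ℝ} (ha : 0 < a)
    (h : ∀ x, a * ‖x‖ ^ 2 - C * ‖x‖ ≤ inner ℝ (P x) x) : ∃ x, P x = 0 := by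
  have hR : 0 < (|C| + 1) / a := by positivity
  refine exists_eq_zero_of_inner_pos hP hR fun x hx => lt_of_lt_of_le ?_ (h x)
  have h1 : a * ‖x‖ = |C| + 1 := by rw [hx]; field_simp
  have h2 : 0 < ‖x‖ := hx ▸ hR
  nlinarith [le_abs_self C]

end ZeroOfField

end PorousMedium

namespace PorousMedium

/-! ### The nonlinearity and its inverse. -/

section Beta

theorem abs_beta {m : ℝ} (hm : 0 < m) (s : ℝ) : |beta m s| = |s| ^ m := by
  rcases eq_or_ne s 0 with rfl | hs
  · simp [beta, Real.zero_rpow hm.ne']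
  · rw [beta, abs_mul, abs_of_nonneg (by positivity), ← Real.rpow_add_one (abs_ne_zero.2 hs),
      sub_add_cancel]

theorem continuous_beta {m : ℝ} (hm : 0 < m) : Continuous (beta m) := by
  rw [continuous_iff_continuousAt]
  intro s
  rcases eq_or_ne s 0 with rfl | hs
  · have h0 : beta m 0 = 0 := by simp [beta]
    rw [ContinuousAt, h0, tendsto_zero_iff_abs_tendsto_zero]
    have h : Continuous fun s : ℝ => |s| ^ m :=
      continuous_abs.rpow_const fun _ => Or.inr hm.le
    have h' := h.tendsto 0
    rw [abs_zero, Real.zero_rpow hm.ne'] at h'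
    exact h'.congr fun s => (abs_beta hm s).symm
  · exact (continuous_abs.continuousAt.rpow_const (Or.inl (abs_ne_zero.2 hs))).mul continuousAt_id

theorem beta_beta_inv {m : ℝ} (hm : 0 < m) (s : ℝ) : beta m (beta m⁻¹ s) = s := by
  rcases eq_or_ne s 0 with rfl | hs
  · simp [beta]
  · have h : (0 : ℝ) < |s| := abs_pos.2 hs
    rw [beta, abs_beta (inv_pos.2 hm), beta, ← mul_assoc, ← Real.rpow_mul h.le, ← Real.rpow_add h]
    have : m⁻¹ * (m - 1) + (m⁻¹ - 1) = 0 := by field_simp; ring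
    rw [this, Real.rpow_zero, one_mul]

theorem beta_mul_self_nonneg (m s : ℝ) : 0 ≤ beta m s * s := by
  rw [beta, mul_assoc]
  exact mul_nonneg (by positivity) (mul_self_nonneg s)

end Beta

/-! ### Bounds on a symmetric quadratic form. -/

section Tensor

variable {d : ℕ}

theorem inner_toEuclideanLin (M : Matrix (Fin d) (Fin d) ℝ) (ξ η : EuclideanSpace ℝ (Fin d)) :
    inner ℝ (Matrix.toEuclideanLin M ξ) η = ∑ i, ∑ j, M i j * ξ j * η i := by
  simp [PiLp.inner_apply, Matrix.toLpLin_apply, Matrix.mulVec, dotProduct, Finset.mul_sum,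
    mul_comm]

theorem inner_toEuclideanLin_comm {M : Matrix (Fin d) (Fin d) ℝ} (hM : M.IsSymm)
    (ξ η : EuclideanSpace ℝ (Fin d)) :
    inner ℝ (Matrix.toEuclideanLin M ξ) η = inner ℝ (Matrix.toEuclideanLin M η) ξ := by
  rw [inner_toEuclideanLin, inner_toEuclideanLin, Finset.sum_comm]
  refine Finset.sum_congr rfl fun i _ => Finset.sum_congr rfl fun j _ => ?_
  rw [hM.apply]
  ring

theorem abs_inner_toEuclideanLin_le {M : Matrix (Fin d) (Fin d) ℝ} (hM : M.IsSymm) {hi : ℝ}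
    (h0 : ∀ ξ, 0 ≤ inner ℝ (Matrix.toEuclideanLin M ξ) ξ)
    (h1 : ∀ ξ, inner ℝ (Matrix.toEuclideanLin M ξ) ξ ≤ hi * ‖ξ‖ ^ 2)
    (ξ η : EuclideanSpace ℝ (Fin d)) :
    |inner ℝ (Matrix.toEuclideanLin M ξ) η| ≤ hi * (‖ξ‖ ^ 2 + ‖η‖ ^ 2) := by
  -- Nonnegativity at `ξ + η` and `ξ - η` bounds twice the cross term, up to sign, by the sum of the
  -- two diagonal terms.
  have hp := h0 (ξ + η)
  have hq := h0 (ξ - η)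
  simp only [map_add, map_sub, inner_add_left, inner_add_right, inner_sub_left,
    inner_sub_right] at hp hq
  rw [inner_toEuclideanLin_comm hM η ξ] at hp hq
  have hξ := h1 ξ
  have hη := h1 η
  have hξ0 := h0 ξ
  have hη0 := h0 η
  rw [abs_le]
  constructor <;> linarith

end Tensor

/-! ### Mass and diffusion forms in space, and one time step. -/

namespace GradientDiscretisation

variable {d : ℕ} {Ω : Set (EuclideanSpace ℝ (Fin d))} {m T : ℝ}
  {X : Type*} [AddCommGroup X] [Module ℝ X] [FiniteDimensional ℝ X]
  {ι : Type*} [Fintype ι] (D : GradientDiscretisation Ω m T X ι)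

/-- The function equal to `c i` on the `i`-th cell and to `0` off the cells. -/
noncomputable def cellwise (c : ι → ℝ) (x : EuclideanSpace ℝ (Fin d)) : ℝ :=
  ∑ i, c i * (D.cell i).indicator (fun _ => (1 : ℝ)) x

theorem cellwise_of_mem (c : ι → ℝ) {k : ι} {x : EuclideanSpace ℝ (Fin d)} (hx : x ∈ D.cell k) :
    D.cellwise c x = c k := by
  rw [cellwise, Finset.sum_eq_single k]
  · simp [hx]
  · intro i _ hi
    have : x ∉ D.cell i := fun h => (D.cell_disjoint hi).le_bot ⟨h, hx⟩
    simp [this]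
  · simp

theorem cellwise_of_forall_notMem (c : ι → ℝ) {x : EuclideanSpace ℝ (Fin d)}
    (hx : ∀ k, x ∉ D.cell k) : D.cellwise c x = 0 := by
  simp [cellwise, hx]

theorem continuous_cellwise (x : EuclideanSpace ℝ (Fin d)) :
    Continuous fun c : ι → ℝ => D.cellwise c x := by
  unfold cellwise
  fun_prop

theorem recon_ae_eq (v : X) : D.recon v =ᵐ[volume.restrict Ω] D.cellwise (D.basis.repr v) :=
  D.recon_eq v

/-- Measurability of the cells is not assumed: it comes from the indicator being a.e. the
reconstruction of a basis vector. -/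
theorem aemeasurable_indicator_cell (k : ι) :
    AEMeasurable ((D.cell k).indicator fun _ => (1 : ℝ)) (volume.restrict Ω) := by
  classical
  refine (Lp.aestronglyMeasurable (D.recon (D.basis k))).aemeasurable.congr ?_
  filter_upwards [D.recon_ae_eq (D.basis k)] with x hx
  simp [hx, cellwise, Finsupp.single_apply]

@[simp]
theorem repr_nodal (g : ℝ → ℝ) (v : X) (i : ι) :
    D.basis.repr (D.nodal g v) i = g (D.basis.repr v i) := by
  classical
  simp [nodal, Finsupp.single_apply]

theorem nodal_nodal (g h : ℝ → ℝ) (v : X) : D.nodal g (D.nodal h v) = D.nodal (g ∘ h) v := by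
  rw [nodal]
  simp only [repr_nodal]
  rfl

theorem nodal_id (v : X) : D.nodal id v = v := by
  simp [nodal, D.basis.sum_repr]

theorem integrable_recon_mul_recon [IsFiniteMeasure (volume.restrict Ω)] (u v : X) :
    Integrable (fun x => D.recon u x * D.recon v x) (volume.restrict Ω) :=
  ((Lp.memLp (D.recon v)).integrable le_top).mul_of_top_right (Lp.memLp (D.recon u))

/-- The `L²` pairing of reconstructions. -/
noncomputable def massForm [IsFiniteMeasure (volume.restrict Ω)] : X →ₗ[ℝ] X →ₗ[ℝ] ℝ :=
  have hint := D.integrable_recon_mul_recon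
  LinearMap.mk₂ ℝ (fun u v => ∫ x in Ω, D.recon u x * D.recon v x)
    (fun u u' v => by
      rw [← integral_add (hint u v) (hint u' v)]
      refine integral_congr_ae ?_
      rw [map_add]
      filter_upwards [Lp.coeFn_add (D.recon u) (D.recon u')] with x hx
      rw [hx, Pi.add_apply, add_mul])
    (fun a u v => by
      rw [smul_eq_mul, ← integral_const_mul]
      refine integral_congr_ae ?_
      rw [map_smul]
      filter_upwards [Lp.coeFn_smul a (D.recon u)] with x hx
      rw [hx, Pi.smul_apply, smul_eq_mul, mul_assoc])
    (fun u v v' => by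
      rw [← integral_add (hint u v) (hint u v')]
      refine integral_congr_ae ?_
      rw [map_add]
      filter_upwards [Lp.coeFn_add (D.recon v) (D.recon v')] with x hx
      rw [hx, Pi.add_apply, mul_add])
    (fun a u v => by
      rw [smul_eq_mul, ← integral_const_mul]
      refine integral_congr_ae ?_
      rw [map_smul]
      filter_upwards [Lp.coeFn_smul a (D.recon v)] with x hx
      rw [hx, Pi.smul_apply, smul_eq_mul, mul_left_comm])

theorem massForm_apply [IsFiniteMeasure (volume.restrict Ω)] (u v : X) :
    D.massForm u v = ∫ x in Ω, D.recon u x * D.recon v x :=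
  rfl

/-- Disjoint cells make the integrand equal to `g(v_k) v_k` on cell `k` and zero off the cells. -/
theorem massForm_nodal_self_nonneg [IsFiniteMeasure (volume.restrict Ω)] {g : ℝ → ℝ}
    (hg : ∀ s, 0 ≤ g s * s) (v : X) : 0 ≤ D.massForm (D.nodal g v) v := by
  rw [massForm_apply]
  refine integral_nonneg_of_ae ?_
  filter_upwards [D.recon_ae_eq (D.nodal g v), D.recon_ae_eq v] with x h1 h2
  rw [h1, h2, Pi.zero_apply]
  by_cases hx : ∃ k, x ∈ D.cell k
  · obtain ⟨k, hk⟩ := hx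
    rw [D.cellwise_of_mem _ hk, D.cellwise_of_mem _ hk, repr_nodal]
    exact hg _
  · push Not at hx
    rw [D.cellwise_of_forall_notMem _ hx, zero_mul]

variable {Λ : EuclideanSpace ℝ (Fin d) → ℝ → Matrix (Fin d) (Fin d) ℝ}

/-- Since `cellwise c` takes finitely many values, the composition is a finite sum of sections `Λ(·,
s)` cut off by cells; the value `s = 0` serves off the cells. -/
theorem aemeasurable_tensor_cellwise (hΛ : IsDiffusionTensor Ω Λ) (c : ι → ℝ) (i j : Fin d) :
    AEMeasurable (fun x => Λ x (D.cellwise c x) i j) (volume.restrict Ω) := by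
  have h : (fun x => Λ x (D.cellwise c x) i j) = fun x =>
      Λ x 0 i j + D.cellwise (fun k => Λ x (c k) i j - Λ x 0 i j) x := by
    funext x
    by_cases hx : ∃ k, x ∈ D.cell k
    · obtain ⟨k, hk⟩ := hx
      rw [D.cellwise_of_mem _ hk, D.cellwise_of_mem _ hk]
      ring
    · push Not at hx
      rw [D.cellwise_of_forall_notMem _ hx, D.cellwise_of_forall_notMem _ hx, add_zero]
  rw [h]
  unfold cellwise
  refine (hΛ.measurable 0 i j).add (Finset.aemeasurable_fun_sum _ fun k _ => ?_)
  exact ((hΛ.measurable (c k) i j).sub (hΛ.measurable 0 i j)).mul (D.aemeasurable_indicator_cell k)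

theorem aestronglyMeasurable_inner_tensor (hΛ : IsDiffusionTensor Ω Λ) (c : ι → ℝ)
    (ξ η : Lp (EuclideanSpace ℝ (Fin d)) 2 (volume.restrict Ω)) :
    AEStronglyMeasurable (fun x => inner ℝ (Matrix.toEuclideanLin (Λ x (D.cellwise c x)) (ξ x))
      (η x)) (volume.restrict Ω) := by
  simp only [inner_toEuclideanLin]
  refine AEMeasurable.aestronglyMeasurable ?_
  have hcoord : ∀ (ζ : Lp (EuclideanSpace ℝ (Fin d)) 2 (volume.restrict Ω)) (i : Fin d),
      AEMeasurable (fun x => ζ x i) (volume.restrict Ω) := fun ζ i =>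
    (EuclideanSpace.proj (𝕜 := ℝ) i).continuous.measurable.comp_aemeasurable
      (Lp.aestronglyMeasurable ζ).aemeasurable
  exact Finset.aemeasurable_fun_sum _ fun i _ => Finset.aemeasurable_fun_sum _ fun j _ =>
    ((D.aemeasurable_tensor_cellwise hΛ c i j).mul (hcoord ξ j)).mul (hcoord η i)

theorem exists_bound_inner_tensor (hΩ : MeasurableSet Ω) (hΛ : IsDiffusionTensor Ω Λ) :
    ∃ hi : ℝ, ∀ᵐ x ∂(volume.restrict Ω), ∀ (s : ℝ) (ξ η : EuclideanSpace ℝ (Fin d)),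
      |inner ℝ (Matrix.toEuclideanLin (Λ x s) ξ) η| ≤ hi * (‖ξ‖ ^ 2 + ‖η‖ ^ 2) := by
  obtain ⟨lo, hi, hlo, -, h⟩ := hΛ.elliptic
  refine ⟨hi, ?_⟩
  filter_upwards [h, ae_restrict_mem hΩ] with x hx hxΩ s ξ η
  exact abs_inner_toEuclideanLin_le (hΛ.symm x hxΩ s)
    (fun ζ => le_trans (by positivity) (hx s ζ).1) (fun ζ => (hx s ζ).2) ξ η

theorem integrable_norm_sq_add_norm_sq (a : ℝ)
    (ξ η : Lp (EuclideanSpace ℝ (Fin d)) 2 (volume.restrict Ω)) :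
    Integrable (fun x => a * (‖ξ x‖ ^ 2 + ‖η x‖ ^ 2)) (volume.restrict Ω) :=
  (((Lp.memLp ξ).integrable_norm_pow two_ne_zero).add
    ((Lp.memLp η).integrable_norm_pow two_ne_zero)).const_mul a

theorem integrable_inner_tensor (hΩ : MeasurableSet Ω) (hΛ : IsDiffusionTensor Ω Λ) (w : X)
    (ξ η : Lp (EuclideanSpace ℝ (Fin d)) 2 (volume.restrict Ω)) :
    Integrable (fun x => inner ℝ (Matrix.toEuclideanLin (Λ x (D.recon w x)) (ξ x)) (η x))
      (volume.restrict Ω) := by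
  obtain ⟨hi, h⟩ := exists_bound_inner_tensor hΩ hΛ
  refine (integrable_norm_sq_add_norm_sq hi ξ η).mono' ?_ ?_
  · refine (D.aestronglyMeasurable_inner_tensor hΛ (D.basis.repr w) ξ η).congr ?_
    filter_upwards [D.recon_ae_eq w] with x hx
    rw [hx]
  · filter_upwards [h] with x hx
    exact hx _ _ _

/-- Dominated convergence: `Λ` is continuous in `s`, and its upper bound does not depend on `s`. -/
theorem continuous_integral_inner_tensor (hΩ : MeasurableSet Ω) (hΛ : IsDiffusionTensor Ω Λ)
    (ξ η : Lp (EuclideanSpace ℝ (Fin d)) 2 (volume.restrict Ω)) :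
    Continuous fun c : ι → ℝ => ∫ x in Ω,
      inner ℝ (Matrix.toEuclideanLin (Λ x (D.cellwise c x)) (ξ x)) (η x) := by
  obtain ⟨hi, h⟩ := exists_bound_inner_tensor hΩ hΛ
  refine continuous_of_dominated (fun c => D.aestronglyMeasurable_inner_tensor hΛ c ξ η)
    (fun c => ?_) (integrable_norm_sq_add_norm_sq hi ξ η) ?_
  · filter_upwards [h] with x hx
    exact hx _ _ _
  · filter_upwards [ae_restrict_mem hΩ] with x hx
    simp only [inner_toEuclideanLin]
    have h1 : Continuous fun c : ι → ℝ => Λ x (D.cellwise c x) :=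
      (hΛ.continuous x hx).comp (D.continuous_cellwise x)
    refine continuous_finsetSum _ fun i _ => continuous_finsetSum _ fun j _ => ?_
    exact ((h1.matrix_elem i j).mul continuous_const).mul continuous_const

/-- The diffusion form with coefficient frozen at `Π_D w`. -/
noncomputable def diffusionForm (hΩ : MeasurableSet Ω) (hΛ : IsDiffusionTensor Ω Λ) (w : X) :
    X →ₗ[ℝ] X →ₗ[ℝ] ℝ :=
  have hint := fun u v => D.integrable_inner_tensor hΩ hΛ w (D.grad u) (D.grad v)
  LinearMap.mk₂ ℝ (fun u v => ∫ x in Ω,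
      inner ℝ (Matrix.toEuclideanLin (Λ x (D.recon w x)) (D.grad u x)) (D.grad v x))
    (fun u u' v => by
      rw [← integral_add (hint u v) (hint u' v)]
      refine integral_congr_ae ?_
      rw [map_add]
      filter_upwards [Lp.coeFn_add (D.grad u) (D.grad u')] with x hx
      rw [hx, Pi.add_apply, map_add, inner_add_left])
    (fun a u v => by
      rw [smul_eq_mul, ← integral_const_mul]
      refine integral_congr_ae ?_
      rw [map_smul]
      filter_upwards [Lp.coeFn_smul a (D.grad u)] with x hx
      rw [hx, Pi.smul_apply, map_smul, real_inner_smul_left])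
    (fun u v v' => by
      rw [← integral_add (hint u v) (hint u v')]
      refine integral_congr_ae ?_
      rw [map_add]
      filter_upwards [Lp.coeFn_add (D.grad v) (D.grad v')] with x hx
      rw [hx, Pi.add_apply, inner_add_right])
    (fun a u v => by
      rw [smul_eq_mul, ← integral_const_mul]
      refine integral_congr_ae ?_
      rw [map_smul]
      filter_upwards [Lp.coeFn_smul a (D.grad v)] with x hx
      rw [hx, Pi.smul_apply, real_inner_smul_right])

theorem diffusionForm_apply (hΩ : MeasurableSet Ω) (hΛ : IsDiffusionTensor Ω Λ) (w u v : X) :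
    D.diffusionForm hΩ hΛ w u v = ∫ x in Ω,
      inner ℝ (Matrix.toEuclideanLin (Λ x (D.recon w x)) (D.grad u x)) (D.grad v x) :=
  rfl

theorem diffusionForm_eq_cellwise (hΩ : MeasurableSet Ω) (hΛ : IsDiffusionTensor Ω Λ) (w u v : X) :
    D.diffusionForm hΩ hΛ w u v = ∫ x in Ω,
      inner ℝ (Matrix.toEuclideanLin (Λ x (D.cellwise (D.basis.repr w) x)) (D.grad u x))
        (D.grad v x) := by
  rw [diffusionForm_apply]
  refine integral_congr_ae ?_
  filter_upwards [D.recon_ae_eq w] with x hx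
  rw [hx]

theorem exists_coercive_diffusionForm (hΩ : MeasurableSet Ω) (hΛ : IsDiffusionTensor Ω Λ) :
    ∃ lo : ℝ, 0 < lo ∧ ∀ w v : X, lo * ‖D.grad v‖ ^ 2 ≤ D.diffusionForm hΩ hΛ w v v := by
  obtain ⟨lo, hi, hlo, -, h⟩ := hΛ.elliptic
  refine ⟨lo, hlo, fun w v => ?_⟩
  have h2 : ‖D.grad v‖ ^ 2 = ∫ x in Ω, ‖D.grad v x‖ ^ 2 := by
    rw [← real_inner_self_eq_norm_sq, L2.inner_def]
    simp_rw [real_inner_self_eq_norm_sq]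
  rw [h2, ← integral_const_mul, diffusionForm_apply]
  refine integral_mono_ae (((Lp.memLp (D.grad v)).integrable_norm_pow two_ne_zero).const_mul lo)
    (D.integrable_inner_tensor hΩ hΛ w _ _) ?_
  filter_upwards [h] with x hx
  exact (hx _ _).1

/-- Solvability of one step of the implicit scheme. -/
theorem exists_step [IsFiniteMeasure (volume.restrict Ω)] (hΩ : MeasurableSet Ω)
    (hΛ : IsDiffusionTensor Ω Λ) (hm : 0 < m) {τ : ℝ} (hτ : 0 < τ) (w : X) (L : X →ₗ[ℝ] ℝ) :
    ∃ u : X, ∀ φ : X, D.massForm (u - w) φ +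
      τ * D.diffusionForm hΩ hΛ u (D.nodal (beta m) u) φ = L φ := by
  let J : EuclideanSpace ℝ ι ≃ₗ[ℝ] X := (WithLp.linearEquiv 2 ℝ (ι → ℝ)).trans D.basis.equivFun.symm
  -- The coordinates `v` stand for `β(u)`, and `U v` is the corresponding `u`.
  let U : EuclideanSpace ℝ ι → X := fun v => D.nodal (beta m⁻¹) (J v)
  have hJ : ∀ v, J v = ∑ i, v i • D.basis i := fun v => by
    simp [J, Module.Basis.equivFun_symm_apply]
  have hrepr : ∀ v i, D.basis.repr (J v) i = v i := fun v i => by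
    rw [← Module.Basis.equivFun_apply]
    simp only [J, LinearEquiv.trans_apply, LinearEquiv.apply_symm_apply]
    rfl
  have hU : ∀ v, U v = ∑ i, beta m⁻¹ (v i) • D.basis i := fun v => by
    simp only [U, nodal, hrepr]
  have hβU : ∀ v, D.nodal (beta m) (U v) = J v := fun v => by
    have : beta m ∘ beta m⁻¹ = id := funext (beta_beta_inv hm)
    rw [nodal_nodal, this, nodal_id]
  let P : EuclideanSpace ℝ ι → EuclideanSpace ℝ ι := fun v => WithLp.toLp 2 fun i =>
    D.massForm (U v - w) (D.basis i) + τ * D.diffusionForm hΩ hΛ (U v) (J v) (D.basis i) -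
      L (D.basis i)
  have hPapply : ∀ v i, P v i = D.massForm (U v - w) (D.basis i) +
      τ * D.diffusionForm hΩ hΛ (U v) (J v) (D.basis i) - L (D.basis i) := fun _ _ => rfl
  have hP : Continuous P := by
    refine (PiLp.continuous_toLp 2 _).comp (continuous_pi fun i => ?_)
    have hcoord : ∀ k, Continuous fun v : EuclideanSpace ℝ ι => v k := fun k =>
      (EuclideanSpace.proj (𝕜 := ℝ) k).continuous
    have hγ : ∀ k, Continuous fun v : EuclideanSpace ℝ ι => beta m⁻¹ (v k) := fun k =>
      (continuous_beta (inv_pos.2 hm)).comp (hcoord k)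
    refine (Continuous.add ?_ (continuous_const.mul ?_)).sub continuous_const
    · simp only [hU, map_sub, map_sum, map_smul, LinearMap.sub_apply, LinearMap.sum_apply,
        LinearMap.smul_apply, smul_eq_mul]
      fun_prop
    · have hA : ∀ k, Continuous fun v => D.diffusionForm hΩ hΛ (U v) (D.basis k) (D.basis i) := by
        intro k
        simp only [diffusionForm_eq_cellwise, U]
        have hc : Continuous fun v : EuclideanSpace ℝ ι =>
            (fun k => D.basis.repr (D.nodal (beta m⁻¹) (J v)) k : ι → ℝ) := by
          refine continuous_pi fun k => ?_
          simp only [repr_nodal, hrepr]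
          exact hγ k
        exact (D.continuous_integral_inner_tensor hΩ hΛ (D.grad (D.basis k))
          (D.grad (D.basis i))).comp hc
      have hsum : ∀ v, D.diffusionForm hΩ hΛ (U v) (J v) (D.basis i) =
          ∑ k, v k * D.diffusionForm hΩ hΛ (U v) (D.basis k) (D.basis i) := fun v => by
        rw [hJ]
        simp only [map_sum, map_smul, LinearMap.sum_apply, LinearMap.smul_apply, smul_eq_mul]
      simp only [hsum]
      exact continuous_finsetSum _ fun k _ => (hcoord k).mul (hA k)
  -- Pairing `P v` with `z` is testing the residual against `J z`. Taking `z = v` gives coercivity,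
  -- and a zero of `P` gives the equation for every test vector.
  have hsum : ∀ v z, inner ℝ (P v) z = D.massForm (U v - w) (J z) +
      τ * D.diffusionForm hΩ hΛ (U v) (J v) (J z) - L (J z) := by
    intro v z
    rw [hJ z]
    simp only [PiLp.inner_apply, hPapply, map_sum, map_smul, smul_eq_mul, Finset.mul_sum,
      ← Finset.sum_add_distrib, ← Finset.sum_sub_distrib]
    refine Finset.sum_congr rfl fun i _ => ?_
    simp only [RCLike.inner_apply, conj_trivial]
    ring
  obtain ⟨lo, hlo, hcoer⟩ := D.exists_coercive_diffusionForm hΩ hΛ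
  -- Injectivity in finite dimension gives `‖v‖ ≤ K ‖∇ J v‖`, hence the factor `K⁻²` in the
  -- coercivity constant below.
  have hker : LinearMap.ker (D.grad ∘ₗ J.toLinearMap) = ⊥ := by
    rw [LinearMap.ker_eq_bot']
    intro v hv
    exact J.map_eq_zero_iff.1 (D.grad_norm_definite (J v) (by
      have : D.grad (J v) = 0 := hv
      rw [this, norm_zero]))
  obtain ⟨K, hK0, hK⟩ := LinearMap.exists_antilipschitzWith _ hker
  -- All terms linear in `v`: the load and the mass of the previous iterate `w`.
  let ℓ : EuclideanSpace ℝ ι →L[ℝ] ℝ :=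
    LinearMap.toContinuousLinearMap ((L + D.massForm w) ∘ₗ J.toLinearMap)
  have hK0' : (0 : ℝ) < K := hK0
  obtain ⟨v, hv⟩ := exists_eq_zero_of_coercive hP (a := τ * (lo * (K : ℝ)⁻¹ ^ 2)) (C := ‖ℓ‖)
    (by positivity) (fun v => by
      rw [hsum]
      have h1 : (K : ℝ)⁻¹ * ‖v‖ ≤ ‖D.grad (J v)‖ := by
        rw [inv_mul_le_iff₀ hK0']
        simpa using hK.le_mul_dist v 0
      have h2 : (K : ℝ)⁻¹ ^ 2 * ‖v‖ ^ 2 ≤ ‖D.grad (J v)‖ ^ 2 := by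
        rw [← mul_pow]; gcongr
      have h3 := hcoer (U v) (J v)
      have h4 := D.massForm_nodal_self_nonneg (beta_mul_self_nonneg m⁻¹) (J v)
      have h5 : L (J v) + D.massForm w (J v) ≤ ‖ℓ‖ * ‖v‖ :=
        (le_abs_self _).trans (ℓ.le_opNorm v)
      have h6 : τ * (lo * ((K : ℝ)⁻¹ ^ 2 * ‖v‖ ^ 2)) ≤
          τ * D.diffusionForm hΩ hΛ (U v) (J v) (J v) := by
        have := (mul_le_mul_of_nonneg_left h2 hlo.le).trans h3
        gcongr
      rw [map_sub, LinearMap.sub_apply]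
      linarith)
  refine ⟨U v, fun φ => ?_⟩
  have h := hsum v (J.symm φ)
  rw [hv, inner_zero_left, LinearEquiv.apply_symm_apply] at h
  rw [hβU]
  linarith

end GradientDiscretisation

end PorousMedium

namespace PorousMedium

theorem restrict_cylinder {d : ℕ} (Ω : Set (EuclideanSpace ℝ (Fin d))) (T : ℝ) :
    (volume : Measure (ℝ × EuclideanSpace ℝ (Fin d))).restrict (cylinder Ω T) =
      ((volume : Measure ℝ).restrict (Ioc 0 T)).prod (volume.restrict Ω) := by
  rw [cylinder, Measure.volume_eq_prod, ← Measure.prod_restrict,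
    Measure.restrict_congr_set Ioo_ae_eq_Ioc]

/-! ### Space-time integrals as sums over time steps. -/

namespace GradientDiscretisation

variable {d : ℕ} {Ω : Set (EuclideanSpace ℝ (Fin d))} {m T : ℝ}
  {X : Type*} [AddCommGroup X] [Module ℝ X] [FiniteDimensional ℝ X]
  {ι : Type*} [Fintype ι] (D : GradientDiscretisation Ω m T X ι)

/-- The indicator function of the `n`-th time interval. -/
noncomputable def timeInd (n : Fin D.N) : ℝ → ℝ :=
  (Ioc (D.time n.castSucc) (D.time n.succ)).indicator fun _ => 1

theorem disjoint_time {n k : Fin D.N} (h : n ≠ k) :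
    Disjoint (Ioc (D.time n.castSucc) (D.time n.succ))
      (Ioc (D.time k.castSucc) (D.time k.succ)) := by
  wlog hlt : n < k generalizing n k
  · exact (this h.symm (lt_of_le_of_ne (not_lt.1 hlt) h.symm)).symm
  have hle : D.time n.succ ≤ D.time k.castSucc :=
    D.time_strictMono.monotone (Fin.succ_le_castSucc_iff.2 hlt)
  rw [Set.disjoint_left]
  intro t h1 h2
  exact absurd (h1.2.trans hle) (not_le.2 h2.1)

theorem piecewiseInTime_of_mem {F : Type*} [AddCommMonoid F]
    (w : Fin D.N → EuclideanSpace ℝ (Fin d) → F) {n : Fin D.N}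
    {p : ℝ × EuclideanSpace ℝ (Fin d)} (hp : p.1 ∈ Ioc (D.time n.castSucc) (D.time n.succ)) :
    D.piecewiseInTime w p = w n p.2 := by
  rw [piecewiseInTime, Finset.sum_eq_single n]
  · exact indicator_of_mem hp _
  · intro k _ hk
    exact indicator_of_notMem (fun h => Set.disjoint_left.1 (D.disjoint_time hk) h hp) _
  · simp

theorem piecewiseInTime_of_forall_notMem {F : Type*} [AddCommMonoid F]
    (w : Fin D.N → EuclideanSpace ℝ (Fin d) → F) {p : ℝ × EuclideanSpace ℝ (Fin d)}
    (hp : ∀ n : Fin D.N, p.1 ∉ Ioc (D.time n.castSucc) (D.time n.succ)) :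
    D.piecewiseInTime w p = 0 :=
  Finset.sum_eq_zero fun n _ => indicator_of_notMem (hp n) _

theorem piecewiseInTime_eq_sum (w : Fin D.N → EuclideanSpace ℝ (Fin d) → ℝ)
    (p : ℝ × EuclideanSpace ℝ (Fin d)) :
    D.piecewiseInTime w p = ∑ n, D.timeInd n p.1 * w n p.2 := by
  refine Finset.sum_congr rfl fun n _ => ?_
  by_cases h : p.1 ∈ Ioc (D.time n.castSucc) (D.time n.succ) <;> simp [timeInd, h]

theorem reconST_of_ne_zero (v : Fin (D.N + 1) → X) {p : ℝ × EuclideanSpace ℝ (Fin d)}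
    (hp : p.1 ≠ 0) : D.reconST v p = D.piecewiseInTime (fun n => D.recon (v n.succ)) p :=
  if_neg hp

theorem integral_timeInd (n : Fin D.N) :
    ∫ t in Ioc 0 T, D.timeInd n t = D.time n.succ - D.time n.castSucc := by
  have hsub : Ioc (D.time n.castSucc) (D.time n.succ) ⊆ Ioc 0 T := by
    have h0 : 0 ≤ D.time n.castSucc :=
      D.time_zero ▸ D.time_strictMono.monotone (Fin.zero_le _)
    have h1 : D.time n.succ ≤ T :=
      (D.time_strictMono.monotone (Fin.le_last _)).trans_eq D.time_last
    exact Ioc_subset_Ioc h0 h1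
  have hle : D.time n.castSucc ≤ D.time n.succ :=
    D.time_strictMono.monotone (Fin.castSucc_lt_succ).le
  rw [timeInd, setIntegral_indicator measurableSet_Ioc, inter_eq_self_of_subset_right hsub]
  simp [hle]

theorem integrable_timeInd (n : Fin D.N) :
    Integrable (D.timeInd n) (volume.restrict (Ioc 0 T)) :=
  (integrable_const _).indicator measurableSet_Ioc

theorem integral_cylinder_piecewiseInTime {w : Fin D.N → EuclideanSpace ℝ (Fin d) → ℝ}
    (hw : ∀ n, Integrable (w n) (volume.restrict Ω)) :
    ∫ p in cylinder Ω T, D.piecewiseInTime w p =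
      ∑ n, (D.time n.succ - D.time n.castSucc) * ∫ x in Ω, w n x := by
  rw [restrict_cylinder]
  simp only [piecewiseInTime_eq_sum]
  rw [integral_finsetSum _ fun n _ => (D.integrable_timeInd n).mul_prod (hw n)]
  refine Finset.sum_congr rfl fun n _ => ?_
  rw [integral_prod_mul, integral_timeInd]

variable {f : ℝ × EuclideanSpace ℝ (Fin d) → ℝ}

/-- On the finite-measure cylinder `f ∈ L²` is integrable, and the other two factors are essentially
bounded. -/
theorem integrable_source_mul_recon [IsFiniteMeasure (volume.restrict Ω)]
    (hf : MemLp f 2 (volume.restrict (cylinder Ω T))) (n : Fin D.N) (v : X) :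
    Integrable (fun p => D.timeInd n p.1 * (f p * D.recon v p.2))
      (volume.restrict (cylinder Ω T)) := by
  rw [restrict_cylinder] at hf ⊢
  have h1 : Integrable (fun p => f p * D.recon v p.2)
      (((volume : Measure ℝ).restrict (Ioc 0 T)).prod (volume.restrict Ω)) :=
    (hf.integrable one_le_two).mul_of_top_left ((Lp.memLp (D.recon v)).comp_snd _)
  refine h1.bdd_mul (c := 1) (D.integrable_timeInd n).aestronglyMeasurable.comp_fst
    (ae_of_all _ fun p => ?_)
  by_cases h : p.1 ∈ Ioc (D.time n.castSucc) (D.time n.succ) <;> simp [timeInd, h]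

/-- The load `φ ↦ ∫ f Π_D φ` over the `n`-th time slab. -/
noncomputable def load [IsFiniteMeasure (volume.restrict Ω)]
    (hf : MemLp f 2 (volume.restrict (cylinder Ω T))) (n : Fin D.N) : X →ₗ[ℝ] ℝ where
  toFun v := ∫ p in cylinder Ω T, D.timeInd n p.1 * (f p * D.recon v p.2)
  map_add' u v := by
    rw [← integral_add (D.integrable_source_mul_recon hf n u)
      (D.integrable_source_mul_recon hf n v)]
    refine integral_congr_ae ?_
    have h0 : ∀ᵐ x ∂(volume.restrict Ω), D.recon (u + v) x = D.recon u x + D.recon v x := by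
      rw [map_add]
      exact Lp.coeFn_add (D.recon u) (D.recon v)
    have h := Measure.quasiMeasurePreserving_snd (μ := (volume : Measure ℝ).restrict (Ioc 0 T))
      |>.ae h0
    rw [← restrict_cylinder] at h
    filter_upwards [h] with p hp
    rw [hp]
    ring
  map_smul' a v := by
    rw [RingHom.id_apply, smul_eq_mul, ← integral_const_mul]
    refine integral_congr_ae ?_
    have h0 : ∀ᵐ x ∂(volume.restrict Ω), D.recon (a • v) x = a * D.recon v x := by
      rw [map_smul]
      exact Lp.coeFn_smul a (D.recon v)
    have h := Measure.quasiMeasurePreserving_snd (μ := (volume : Measure ℝ).restrict (Ioc 0 T))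
      |>.ae h0
    rw [← restrict_cylinder] at h
    filter_upwards [h] with p hp
    rw [hp]
    ring

theorem fst_ne_zero_of_mem_cylinder {p : ℝ × EuclideanSpace ℝ (Fin d)} (hp : p ∈ cylinder Ω T) :
    p.1 ≠ 0 :=
  hp.1.1.ne'

theorem integral_source_eq [IsFiniteMeasure (volume.restrict Ω)] (hΩ : MeasurableSet Ω)
    (hf : MemLp f 2 (volume.restrict (cylinder Ω T))) (φ : Fin (D.N + 1) → X) :
    ∫ p in cylinder Ω T, f p * D.reconST φ p = ∑ n, D.load hf n (φ n.succ) := by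
  have hcyl : MeasurableSet (cylinder Ω T) := measurableSet_Ioo.prod hΩ
  have h : EqOn (fun p => f p * D.reconST φ p)
      (fun p => ∑ n, D.timeInd n p.1 * (f p * D.recon (φ n.succ) p.2)) (cylinder Ω T) := by
    intro p hp
    simp only [D.reconST_of_ne_zero φ (fst_ne_zero_of_mem_cylinder hp), piecewiseInTime_eq_sum,
      Finset.mul_sum, mul_left_comm]
  rw [setIntegral_congr_fun hcyl h,
    integral_finsetSum _ fun n _ => D.integrable_source_mul_recon hf n _]
  rfl

/-- The length of each time slab cancels the denominator of the difference quotient, so no weight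
remains; the value `φ 0` is seen only at `t = 0`, outside the cylinder. -/
theorem integral_delta_eq [IsFiniteMeasure (volume.restrict Ω)] (hΩ : MeasurableSet Ω)
    (u φ : Fin (D.N + 1) → X) :
    ∫ p in cylinder Ω T, D.deltaST u p * D.reconST φ p =
      ∑ n : Fin D.N, D.massForm (u n.succ - u n.castSucc) (φ n.succ) := by
  have hcyl : MeasurableSet (cylinder Ω T) := measurableSet_Ioo.prod hΩ
  have h : EqOn (fun p => D.deltaST u p * D.reconST φ p)
      (D.piecewiseInTime fun n x => (D.time n.succ - D.time n.castSucc)⁻¹ *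
        (D.recon (u n.succ) x * D.recon (φ n.succ) x -
          D.recon (u n.castSucc) x * D.recon (φ n.succ) x)) (cylinder Ω T) := by
    intro p hp
    simp only [D.reconST_of_ne_zero φ (fst_ne_zero_of_mem_cylinder hp), deltaST]
    by_cases hn : ∃ n : Fin D.N, p.1 ∈ Ioc (D.time n.castSucc) (D.time n.succ)
    · obtain ⟨n, hn⟩ := hn
      simp only [D.piecewiseInTime_of_mem _ hn]
      ring
    · push Not at hn
      simp only [D.piecewiseInTime_of_forall_notMem _ hn, mul_zero]
  rw [setIntegral_congr_fun hcyl h, integral_cylinder_piecewiseInTime]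
  swap
  · exact fun n => ((D.integrable_recon_mul_recon _ _).sub
      (D.integrable_recon_mul_recon _ _)).const_mul _
  refine Finset.sum_congr rfl fun n _ => ?_
  have hne : D.time n.succ - D.time n.castSucc ≠ 0 :=
    (sub_pos.2 (D.time_strictMono Fin.castSucc_lt_succ)).ne'
  rw [integral_const_mul, mul_inv_cancel_left₀ hne, integral_sub (D.integrable_recon_mul_recon _ _)
    (D.integrable_recon_mul_recon _ _), map_sub, LinearMap.sub_apply]
  rfl

variable {Λ : EuclideanSpace ℝ (Fin d) → ℝ → Matrix (Fin d) (Fin d) ℝ}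

theorem integral_diffusion_eq (hΩ : MeasurableSet Ω) (hΛ : IsDiffusionTensor Ω Λ)
    (u v φ : Fin (D.N + 1) → X) :
    ∫ p in cylinder Ω T, inner ℝ (Matrix.toEuclideanLin (Λ p.2 (D.reconST u p)) (D.gradST v p))
        (D.gradST φ p) =
      ∑ n : Fin D.N, (D.time n.succ - D.time n.castSucc) *
        D.diffusionForm hΩ hΛ (u n.succ) (v n.succ) (φ n.succ) := by
  have hcyl : MeasurableSet (cylinder Ω T) := measurableSet_Ioo.prod hΩ
  have h : EqOn (fun p => inner ℝ (Matrix.toEuclideanLin (Λ p.2 (D.reconST u p))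
        (D.gradST v p)) (D.gradST φ p))
      (D.piecewiseInTime fun n x => inner ℝ (Matrix.toEuclideanLin (Λ x (D.recon (u n.succ) x))
        (D.grad (v n.succ) x)) (D.grad (φ n.succ) x)) (cylinder Ω T) := by
    intro p hp
    simp only [D.reconST_of_ne_zero u (fst_ne_zero_of_mem_cylinder hp), gradST]
    by_cases hn : ∃ n : Fin D.N, p.1 ∈ Ioc (D.time n.castSucc) (D.time n.succ)
    · obtain ⟨n, hn⟩ := hn
      simp only [D.piecewiseInTime_of_mem _ hn]
    · push Not at hn
      simp only [D.piecewiseInTime_of_forall_notMem _ hn, inner_zero_right]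
  rw [setIntegral_congr_fun hcyl h, integral_cylinder_piecewiseInTime _ fun n =>
    D.integrable_inner_tensor hΩ hΛ _ _ _]
  rfl

end GradientDiscretisation

end PorousMedium

/-! ### Time marching. -/

theorem mainTheorem5 {d : ℕ} (hd : 1 ≤ d) (Ω : Set (EuclideanSpace ℝ (Fin d)))
    (hΩo : IsOpen Ω) (hΩb : Bornology.IsBounded Ω)
    (m T : ℝ) (hm : 0 < m) (hT : 0 < T)
    (Λ : EuclideanSpace ℝ (Fin d) → ℝ → Matrix (Fin d) (Fin d) ℝ)
    (hΛ : PorousMedium.IsDiffusionTensor Ω Λ)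
    (f : ℝ × EuclideanSpace ℝ (Fin d) → ℝ)
    (hf : MemLp f 2 (volume.restrict (PorousMedium.cylinder Ω T)))
    (u₀ : Lp ℝ (ENNReal.ofReal (m + 1)) (volume.restrict Ω))
    {X : Type*} [AddCommGroup X] [Module ℝ X] [FiniteDimensional ℝ X]
    {ι : Type*} [Fintype ι]
    (D : PorousMedium.GradientDiscretisation Ω m T X ι) :
    ∃ u : Fin (D.N + 1) → X, D.IsSchemeSolution Λ f u₀ u := by
  have hfin : IsFiniteMeasure (volume.restrict Ω) :=
    isFiniteMeasure_restrict.2 hΩb.measure_lt_top.ne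
  have hΩ := hΩo.measurableSet
  have hτ : ∀ n : Fin D.N, 0 < D.time n.succ - D.time n.castSucc := fun n =>
    sub_pos.2 (D.time_strictMono Fin.castSucc_lt_succ)
  -- The load is already integrated over its slab, so only the diffusion term carries the time step
  -- length.
  choose step hstep using fun (n : Fin D.N) (w : X) =>
    D.exists_step hΩ hΛ hm (hτ n) w (D.load hf n)
  let u : Fin (D.N + 1) → X := Fin.induction (D.interp u₀) fun n w => step n w
  have hu : ∀ n : Fin D.N, u n.succ = step n (u n.castSucc) := fun n =>
    Fin.induction_succ _ _ n
  refine ⟨u, Fin.induction_zero _ _, fun φ => ?_⟩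
  rw [D.integral_delta_eq hΩ, D.integral_diffusion_eq hΩ hΛ, D.integral_source_eq hΩ hf,
    ← Finset.sum_add_distrib]
  refine Finset.sum_congr rfl fun n _ => ?_
  rw [hu n]
  exact hstep n (u n.castSucc) (φ n.succ)
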